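/- Theorem 3 (Bias at Small Step-sizes). Let $A_1,A_2,C\in\mathbb{R}^{N\times N}$ be matrices with nonnegative entries $a_{1,lk},a_{2,lk},c_{lk}$ such that $A_1^T\mathbb{1}=\mathbb{1}$, $A_2^T\mathbb{1}=\mathbb{1}$, $C\mathbb{1}=\mathbb{1}$, and let $J_1,\dots,J_N:\mathbb{R}^M\to\mathbb{R}$ be twice differentiable functions for which there are nonnegative numbers $\lambda_{l,\min},\lambda_{l,\max}$ with $\lambda_{l,\min}I_M\le\nabla^2J_l(w)\le\lambda_{l,\max}I_M$ for all $l$ and all $w\in\mathbb{R}^M$, and $\sum_{l=1}^N c_{lk}\lambda_{l,\min}>0$ for every $k$. Let $w^o$ be the minimizer of $J^{\mathrm{glob}}(w)=\sum_{l=1}^N J_l(w)$ over $\mathbb{R}^M$ (a Pareto-optimal point). For step-sizes $\mu_1,\dots,\mu_N>0$ let $T_d=T_{A_2}\circ T_G\circ T_{A_1}$ be the diffusion operator on block vectors $x=\mathrm{col}\{x_1,\dots,x_N\}\in\mathbb{R}^{MN}$, $x_k\in\mathbb{R}^M$, where $T_A(x)=(A^T\otimes I_M)x$ and the $k$-th block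 of $T_G(x)$ is $x_k-\mu_k\sum_{l=1}^N c_{lk}\nabla J_l(x_k)$. Put $\Omega=\mathrm{diag}\{\mu_1,\dots,\mu_N\}$ and $\mu_{\max}=\max_k\mu_k$. Suppose that the right-stochastic matrix $A_2^TA_1^T$ is regular (some power of it has only positive entries), and let $\theta^T\neq 0$ be a real left eigenvector of $A_2^TA_1^T$ of eigenvalue one. Then there are constants $K>0$ and $\mu_0>0$, which do not depend on the step-sizes, such that for all step-sizes with $0<\mu_k\le\mu_0$ $(k=1,\dots,N)$ that satisfy $$\theta^TA_2^T\Omega C^T=c_0\mathbb{1}^T\quad\text{for some constant } c_0$$ (which may depend on the step-sizes), the operator $T_d$ has a unique fixed point $w_\infty$, and $$\|\mathbb{1}_N\otimes w^o-w_\infty\|^2\le K\,\mu_{\max}^2 .$$ That is, $\|\mathbb{1}_N\otimes w^o-w_\infty\|^2=O(\mu_{\max}^2)$ as the step-sizes go to zero subject to the displayed condition. -/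

import Mathlib

open Matrix

noncomputable section

namespace Diffusion

/-- Block vectors `col{x_1, …, x_N}` with blocks in `ℝ^M`, i.e. `ℝ^{MN}` with its Euclidean norm:
`‖x‖² = ∑ k, ‖x k‖²`. -/
abbrev BlockVec (N M : ℕ) : Type :=
  PiLp 2 (fun _ : Fin N => EuclideanSpace ℝ (Fin M))

/-- The block vector `𝟙_N ⊗ w`, all of whose `N` blocks are equal to `w`. -/
def stack (N : ℕ) {M : ℕ} (w : EuclideanSpace ℝ (Fin M)) : BlockVec N M :=
  WithLp.toLp 2 (fun _ => w)

/-- The combination operator `T_A(x) = (Aᵀ ⊗ I_M) x`: its `k`-th block is `∑ l, a_{lk} x_l`. -/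
def combinationOp {N M : ℕ} (A : Matrix (Fin N) (Fin N) ℝ) (x : BlockVec N M) : BlockVec N M :=
  WithLp.toLp 2 (fun k => ∑ l, A l k • x l)

/-- The gradient-descent operator `T_G`: its `k`-th block is
`x_k - μ_k ∑ l, c_{lk} ∇J_l(x_k)`. -/
def gradientDescentOp {N M : ℕ} (μ : Fin N → ℝ) (C : Matrix (Fin N) (Fin N) ℝ)
    (J : Fin N → EuclideanSpace ℝ (Fin M) → ℝ) (x : BlockVec N M) : BlockVec N M :=
  WithLp.toLp 2 (fun k => x k - μ k • ∑ l, C l k • gradient (J l) (x k))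

/-- The (noise-free) diffusion operator `T_d = T_{A₂} ∘ T_G ∘ T_{A₁}`. -/
def diffusionOp {N M : ℕ} (A₁ A₂ C : Matrix (Fin N) (Fin N) ℝ)
    (J : Fin N → EuclideanSpace ℝ (Fin M) → ℝ) (μ : Fin N → ℝ) (x : BlockVec N M) :
    BlockVec N M :=
  combinationOp A₂ (gradientDescentOp μ C J (combinationOp A₁ x))

/-- The bounded Hessian condition: every cost `J_l` is twice differentiable on `ℝ^M`, and there are
nonnegative numbers `λ_{l,min}`, `λ_{l,max}` with
`λ_{l,min} I ≤ ∇²J_l(w) ≤ λ_{l,max} I` (Loewner order) for all `w`, and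
`∑ l, c_{lk} λ_{l,min} > 0` for every `k`. -/
def BoundedHessian {N M : ℕ} (C : Matrix (Fin N) (Fin N) ℝ)
    (J : Fin N → EuclideanSpace ℝ (Fin M) → ℝ) : Prop :=
  (∀ l, Differentiable ℝ (J l) ∧ Differentiable ℝ (gradient (J l))) ∧
  ∃ lmin lmax : Fin N → ℝ,
    (∀ l, 0 ≤ lmin l ∧ 0 ≤ lmax l) ∧
    (∀ l w,
      lmin l • (1 : EuclideanSpace ℝ (Fin M) →L[ℝ] EuclideanSpace ℝ (Fin M))
        ≤ fderiv ℝ (gradient (J l)) w ∧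
      fderiv ℝ (gradient (J l)) w
        ≤ lmax l • (1 : EuclideanSpace ℝ (Fin M) →L[ℝ] EuclideanSpace ℝ (Fin M))) ∧
    ∀ k, 0 < ∑ l, C l k * lmin l

end Diffusion

end

/-! Put `P = A₂ᵀ * A₁ᵀ`, let `φ` be `θ` scaled to a probability vector, let `g k` be the aggregated
gradient, and measure block vectors by the largest block norm. At a fixed point `w`, with `x = A₁ᵀ
w`, one has `(I - P) w = -A₂ᵀ q`, where `q k = μ k • g k (x k)`.

Split the error `w - 𝟙 ⊗ wo` into its `φ`-mean `d` and a disagreement `z` of zero `φ`-mean.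
Primitivity of `P` bounds `z` by `κ ‖q‖`, of order `μ_max`
(`IsPrimitive.exists_norm_le_mul_norm_sub_mix`). Pairing the fixed-point equation with `φ` kills `I
- P`, so the `g k (x k)`, weighted by `(φ ᵥ* A₂ᵀ) k * μ k`, sum to zero. By the step-size condition
the same weighted sum vanishes at `wo`. Strong monotonicity then gives `‖d‖ ≤ (L / m) ‖z‖`
(`norm_mean_le`), free of ratios of step-sizes. For small steps the part of `‖q‖` that is linear in
the error is absorbed (`norm_fixedPoint_sub_le`).

Existence and uniqueness come from a separate contraction argument. -/

/-- Finitely many positive numbers have a positive lower bound. -/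
theorem Finite.exists_pos_forall_le {ι : Type*} [Finite ι] (f : ι → ℝ) (hf : ∀ i, 0 < f i) :
    ∃ δ > 0, ∀ i, δ ≤ f i := by
  cases isEmpty_or_nonempty ι
  · exact ⟨1, one_pos, fun i => isEmptyElim i⟩
  · obtain ⟨i, hi⟩ := Finite.exists_min f
    exact ⟨f i, hf i, hi⟩

namespace Matrix

/-! ### Stochastic matrices acting on block vectors in the sup norm. -/

section Mix

variable {n E : Type*} [Fintype n]

/-- The action of a matrix on vectors whose entries lie in a module, `(B ⊗ I) x`. -/
def mix [AddCommGroup E] [Module ℝ E] (B : Matrix n n ℝ) : (n → E) →ₗ[ℝ] (n → E) where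
  toFun x k := ∑ l, B k l • x l
  map_add' x y := by ext k; simp [Finset.sum_add_distrib]
  map_smul' c x := by
    ext k
    simp only [Pi.smul_apply, Finset.smul_sum, RingHom.id_apply]
    exact Finset.sum_congr rfl fun l _ => smul_comm _ _ _

section Algebra

variable [AddCommGroup E] [Module ℝ E]

theorem mix_apply (B : Matrix n n ℝ) (x : n → E) (k : n) : B.mix x k = ∑ l, B k l • x l := rfl

theorem mix_mul (A B : Matrix n n ℝ) (x : n → E) : (A * B).mix x = A.mix (B.mix x) := by
  ext k
  simp only [mix_apply, Matrix.mul_apply, Finset.sum_smul, Finset.smul_sum, smul_smul]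
  exact Finset.sum_comm

theorem mix_one [DecidableEq n] (x : n → E) : (1 : Matrix n n ℝ).mix x = x := by
  ext k
  simp [mix_apply, Matrix.one_apply]

theorem sum_smul_mix (φ : n → ℝ) (B : Matrix n n ℝ) (x : n → E) :
    ∑ k, φ k • B.mix x k = ∑ k, (φ ᵥ* B) k • x k := by
  simp only [mix_apply, Finset.smul_sum, vecMul, dotProduct, Finset.sum_smul, smul_smul]
  exact Finset.sum_comm

theorem mix_const [DecidableEq n] {B : Matrix n n ℝ} (hB : B ∈ rowStochastic ℝ n) (u : E) :
    B.mix (fun _ => u) = fun _ => u := by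
  ext k
  simp [mix_apply, ← Finset.sum_smul, sum_row_of_mem_rowStochastic hB]

end Algebra

variable [NormedAddCommGroup E] [NormedSpace ℝ E] [DecidableEq n]

theorem norm_mix_le {B : Matrix n n ℝ} (hB : B ∈ rowStochastic ℝ n) (x : n → E) :
    ‖B.mix x‖ ≤ ‖x‖ := by
  refine (pi_norm_le_iff_of_nonneg (norm_nonneg _)).2 fun k => ?_
  calc ‖∑ l, B k l • x l‖ ≤ ∑ l, B k l * ‖x‖ := norm_sum_le_of_le _ fun l _ => by
        rw [norm_smul, Real.norm_of_nonneg (hB.1 k l)]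
        exact mul_le_mul_of_nonneg_left (norm_le_pi_norm x l) (hB.1 k l)
    _ = ‖x‖ := by rw [← Finset.sum_mul, sum_row_of_mem_rowStochastic hB, one_mul]

/-- Telescoping: each of the `k` increments is a power of `P`, nonexpansive, applied to `z - P z`.
-/
theorem norm_sub_mix_pow_le {P : Matrix n n ℝ} (hP : P ∈ rowStochastic ℝ n) (z : n → E) (k : ℕ) :
    ‖z - (P ^ k).mix z‖ ≤ k * ‖z - P.mix z‖ := by
  induction k with
  | zero => simp [mix_one]
  | succ k ih =>
    have h : z - (P ^ (k + 1)).mix z = (z - P.mix z) + P.mix (z - (P ^ k).mix z) := by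
      rw [pow_succ', mix_mul, map_sub]; abel
    rw [h]
    push_cast
    linarith [norm_add_le (z - P.mix z) (P.mix (z - (P ^ k).mix z)),
      norm_mix_le hP (z - (P ^ k).mix z)]

/-- A matrix with entries at least `δ` contracts the vectors of zero `φ`-mean by `1 - δ`. -/
theorem norm_mix_le_of_mean_zero {Q : Matrix n n ℝ} (hQ : Q ∈ rowStochastic ℝ n) {δ : ℝ}
    (hδ : 0 ≤ δ) (hQδ : ∀ i j, δ ≤ Q i j) {φ : n → ℝ} (hφ : ∀ i, 0 ≤ φ i) (hφ1 : ∑ i, φ i = 1)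
    [Nonempty n] {z : n → E} (hz : ∑ k, φ k • z k = 0) : ‖Q.mix z‖ ≤ (1 - δ) * ‖z‖ := by
  refine (pi_norm_le_iff_of_nonempty _).2 fun i => ?_
  -- Since `z` has zero `φ`-mean, `δ φ` may be subtracted from every row; the entries stay
  -- nonnegative and the row sums drop to `1 - δ`.
  have h : Q.mix z i = ∑ j, (Q i j - δ * φ j) • z j := by
    simp only [sub_smul, Finset.sum_sub_distrib, mul_smul, ← Finset.smul_sum, hz, smul_zero,
      sub_zero, mix_apply]
  have hpos : ∀ j, 0 ≤ Q i j - δ * φ j := fun j => by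
    have : φ j ≤ 1 := hφ1 ▸ Finset.single_le_sum (fun k _ => hφ k) (Finset.mem_univ j)
    nlinarith [hQδ i j]
  rw [h]
  calc ‖∑ j, (Q i j - δ * φ j) • z j‖ ≤ ∑ j, (Q i j - δ * φ j) * ‖z‖ :=
        norm_sum_le_of_le _ fun j _ => by
          rw [norm_smul, Real.norm_of_nonneg (hpos j)]
          exact mul_le_mul_of_nonneg_left (norm_le_pi_norm z j) (hpos j)
    _ = (1 - δ) * ‖z‖ := by
      rw [← Finset.sum_mul, Finset.sum_sub_distrib, ← Finset.mul_sum, hφ1,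
        sum_row_of_mem_rowStochastic hQ, mul_one]

/-- `I - P` is bounded below on the vectors of zero `φ`-mean if `P` is primitive. -/
theorem IsPrimitive.exists_norm_le_mul_norm_sub_mix {P : Matrix n n ℝ} (hprim : P.IsPrimitive)
    (hP : P ∈ rowStochastic ℝ n) {φ : n → ℝ} (hφ : ∀ i, 0 ≤ φ i) (hφ1 : ∑ i, φ i = 1)
    [Nonempty n] (E : Type*) [NormedAddCommGroup E] [NormedSpace ℝ E] :
    ∃ κ > 0, ∀ z : n → E, ∑ k, φ k • z k = 0 → ‖z‖ ≤ κ * ‖z - P.mix z‖ := by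
  obtain ⟨k, hk, hpos⟩ := hprim.exists_pos_pow
  obtain ⟨δ, hδ, hle⟩ := Finite.exists_pos_forall_le (fun p : n × n => (P ^ k) p.1 p.2)
    fun p => hpos p.1 p.2
  -- The constant solves `‖z‖ ≤ k ‖z - P z‖ + (1 - δ) ‖z‖`.
  refine ⟨k / δ, by positivity, fun z hz => ?_⟩
  have h1 := norm_mix_le_of_mean_zero (pow_mem hP k) hδ.le (fun i j => hle (i, j)) hφ hφ1 hz
  have h2 := norm_sub_mix_pow_le hP z k
  have h3 := norm_le_norm_sub_add z ((P ^ k).mix z)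
  rw [div_mul_eq_mul_div, le_div_iff₀ hδ]
  linarith

end Mix

/-! ### Left fixed vectors of primitive stochastic matrices. -/

section Perron

variable {n : Type*} [Fintype n] [DecidableEq n]

/-- With entries of both signs, the triangle inequality would be strict in every column; summing
over the columns would give `‖θ‖₁ < ‖θ‖₁`, since rows sum to one. -/
theorem sameSign_of_vecMul_eq_of_pos {Q : Matrix n n ℝ} (hQ : Q ∈ rowStochastic ℝ n)
    (hpos : ∀ i j, 0 < Q i j) {θ : n → ℝ} (h : θ ᵥ* Q = θ) :
    (∀ i, 0 ≤ θ i) ∨ (∀ i, θ i ≤ 0) := by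
  by_contra! hcon
  obtain ⟨⟨b, hb⟩, a, ha⟩ := hcon
  have key : ∀ j, |θ j| < ∑ i, |θ i| * Q i j := fun j => by
    have hj : θ j = ∑ i, θ i * Q i j := (congrFun h j).symm
    rw [abs_lt, hj, neg_lt, ← Finset.sum_neg_distrib]
    constructor
    · refine Finset.sum_lt_sum (fun i _ => ?_) ⟨a, Finset.mem_univ a, ?_⟩
      · nlinarith [neg_abs_le (θ i), hpos i j]
      · nlinarith [abs_of_pos ha, hpos a j]
    · refine Finset.sum_lt_sum (fun i _ => ?_) ⟨b, Finset.mem_univ b, ?_⟩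
      · nlinarith [le_abs_self (θ i), hpos i j]
      · nlinarith [abs_of_neg hb, hpos b j]
  have hsum : ∑ j, |θ j| < ∑ j, ∑ i, |θ i| * Q i j :=
    Finset.sum_lt_sum (fun j _ => (key j).le) ⟨a, Finset.mem_univ a, key a⟩
  rw [Finset.sum_comm] at hsum
  simp only [← Finset.mul_sum, sum_row_of_mem_rowStochastic hQ, mul_one, lt_irrefl] at hsum

theorem vecMul_pow_eq_self {P : Matrix n n ℝ} {θ : n → ℝ} (h : θ ᵥ* P = θ) (k : ℕ) :
    θ ᵥ* P ^ k = θ := by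
  induction k with
  | zero => simp
  | succ k ih => rw [pow_succ, ← vecMul_vecMul, ih, h]

/-- A left fixed vector of a primitive stochastic matrix is a multiple of a probability vector. -/
theorem IsPrimitive.exists_smul_probability {P : Matrix n n ℝ} (hprim : P.IsPrimitive)
    (hP : P ∈ rowStochastic ℝ n) {θ : n → ℝ} (hθ : θ ≠ 0) (h : θ ᵥ* P = θ) :
    ∃ s : ℝ, (∀ i, 0 ≤ (s • θ) i) ∧ ∑ i, (s • θ) i = 1 := by
  obtain ⟨k, -, hpos⟩ := hprim.exists_pos_pow
  have hsign := sameSign_of_vecMul_eq_of_pos (pow_mem hP k) hpos (vecMul_pow_eq_self h k)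
  have hne : ∑ i, θ i ≠ 0 := by
    intro h0
    apply hθ
    ext i
    rcases hsign with hs | hs
    · exact (Finset.sum_eq_zero_iff_of_nonneg fun i _ => hs i).1 h0 i (Finset.mem_univ i)
    · exact (Finset.sum_eq_zero_iff_of_nonpos fun i _ => hs i).1 h0 i (Finset.mem_univ i)
  refine ⟨(∑ i, θ i)⁻¹, fun i => ?_, ?_⟩
  · rw [Pi.smul_apply, smul_eq_mul]
    rcases hsign with hs | hs
    · exact mul_nonneg (inv_nonneg.2 (Finset.sum_nonneg fun i _ => hs i)) (hs i)
    · exact mul_nonneg_of_nonpos_of_nonpos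
        (inv_nonpos.2 (Finset.sum_nonpos fun i _ => hs i)) (hs i)
  · simp only [Pi.smul_apply, smul_eq_mul, ← Finset.mul_sum, inv_mul_cancel₀ hne]

end Perron

end Matrix

/-! ### From Hessian bounds to Lipschitz and monotone gradients. -/

section Gradient

variable {E : Type*} [NormedAddCommGroup E] [InnerProductSpace ℝ E]

theorem ContinuousLinearMap.inner_le_inner_of_le {S T : E →L[ℝ] E} (h : S ≤ T) (x : E) :
    inner ℝ (S x) x ≤ inner ℝ (T x) x := by
  have := ((ContinuousLinearMap.le_def _ _).1 h).inner_nonneg_left x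
  rwa [_root_.sub_apply, inner_sub_left, sub_nonneg] at this

theorem ContinuousLinearMap.inner_smul_one_apply (c : ℝ) (x : E) :
    inner ℝ ((c • (1 : E →L[ℝ] E)) x) x = c * ‖x‖ ^ 2 := by
  rw [_root_.smul_apply, one_apply_eq_self, real_inner_smul_left, real_inner_self_eq_norm_sq]

/-- Cauchy–Schwarz for the semidefinite form `⟨D y, y'⟩`, applied to `x` and `D x`, gives `‖D x‖⁴ ≤
⟨D (D x), D x⟩ ⟨D x, x⟩ ≤ c² ‖D x‖² ‖x‖²`. -/
theorem ContinuousLinearMap.IsPositive.norm_le_of_le_smul_one {D : E →L[ℝ] E} (hD : D.IsPositive)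
    {c : ℝ} (hc : 0 ≤ c) (hle : D ≤ c • (1 : E →L[ℝ] E)) : ‖D‖ ≤ c := by
  have hub : ∀ x, inner ℝ (D x) x ≤ c * ‖x‖ ^ 2 := fun x =>
    (inner_le_inner_of_le hle x).trans_eq (inner_smul_one_apply c x)
  refine D.opNorm_le_bound hc fun x => ?_
  -- The form evaluated at `x + t • D x`; its nonpositive discriminant is the Cauchy–Schwarz
  -- inequality.
  have hquad : ∀ t : ℝ, 0 ≤ inner ℝ (D (D x)) (D x) * (t * t) + (2 * ‖D x‖ ^ 2) * t
      + inner ℝ (D x) x := fun t => by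
    have h := hD.inner_nonneg_left (x + t • D x)
    have hs : inner ℝ (D (D x)) x = ‖D x‖ ^ 2 := by
      rw [hD.inner_left_eq_inner_right, real_inner_self_eq_norm_sq]
    simp only [map_add, map_smul, inner_add_left, inner_add_right, real_inner_smul_left,
      real_inner_smul_right, hs, real_inner_self_eq_norm_sq] at h
    linarith
  have hdisc := discrim_le_zero hquad
  rw [discrim] at hdisc
  have h1 := hub x
  have h2 := hub (D x)
  have h3 := hD.inner_nonneg_left x
  have h4 := hD.inner_nonneg_left (D x)
  have h5 : inner ℝ (D (D x)) (D x) * inner ℝ (D x) x ≤ (c * ‖D x‖ ^ 2) * (c * ‖x‖ ^ 2) :=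
    mul_le_mul h2 h1 h3 (by positivity)
  rcases (norm_nonneg (D x)).eq_or_lt with h0 | h0
  · rw [← h0]; positivity
  · refine le_of_sq_le_sq ?_ (by positivity)
    have h6 : ‖D x‖ ^ 2 * ‖D x‖ ^ 2 ≤ ‖D x‖ ^ 2 * (c * ‖x‖) ^ 2 := by nlinarith
    exact le_of_mul_le_mul_left h6 (by positivity)

theorem norm_image_sub_le_of_fderiv_le {F : E → E} (hF : Differentiable ℝ F) {a c : ℝ}
    (ha : 0 ≤ a) (hc : 0 ≤ c) (hlow : ∀ w, a • (1 : E →L[ℝ] E) ≤ fderiv ℝ F w)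
    (hup : ∀ w, fderiv ℝ F w ≤ c • (1 : E →L[ℝ] E)) (x y : E) :
    ‖F x - F y‖ ≤ c * ‖x - y‖ := by
  refine convex_univ.norm_image_sub_le_of_norm_fderiv_le (𝕜 := ℝ) (fun w _ => hF w) (fun w _ => ?_)
    (Set.mem_univ y) (Set.mem_univ x)
  refine ContinuousLinearMap.IsPositive.norm_le_of_le_smul_one ?_ hc (hup w)
  have h := ((ContinuousLinearMap.le_def _ _).1 (hlow w)).add
    (ContinuousLinearMap.isPositive_one.smul_of_nonneg ha)
  rwa [sub_add_cancel] at h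

/-- Mean value inequality for `t ↦ ⟨F (y + t (x - y)), x - y⟩` on `[0, 1]`. -/
theorem mul_norm_sq_le_inner_of_le_fderiv {F : E → E} (hF : Differentiable ℝ F) {a : ℝ}
    (hlow : ∀ w, a • (1 : E →L[ℝ] E) ≤ fderiv ℝ F w) (x y : E) :
    a * ‖x - y‖ ^ 2 ≤ inner ℝ (F x - F y) (x - y) := by
  have hd : ∀ t : ℝ, HasDerivAt (fun t : ℝ => inner ℝ (F (y + t • (x - y))) (x - y))
      (inner ℝ (fderiv ℝ F (y + t • (x - y)) (x - y)) (x - y)) t := fun t => by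
    have h1 : HasDerivAt (fun t : ℝ => y + t • (x - y)) (x - y) t := by
      simpa using ((hasDerivAt_id t).smul_const (x - y)).const_add y
    have h2 := (hF (y + t • (x - y))).hasFDerivAt.comp_hasDerivAt t h1
    simpa using h2.inner ℝ (hasDerivAt_const t (x - y))
  have h := mul_sub_le_image_sub_of_le_deriv (fun t => (hd t).differentiableAt)
    (C := a * ‖x - y‖ ^ 2) (fun t => by
      rw [(hd t).deriv, ← ContinuousLinearMap.inner_smul_one_apply]
      exact ContinuousLinearMap.inner_le_inner_of_le (hlow _) _) (zero_le_one (α := ℝ))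
  simpa [inner_sub_left] using h

theorem sum_gradient_eq_zero_of_isMinOn [CompleteSpace E] {ι : Type*} [Fintype ι] {J : ι → E → ℝ}
    (hJ : ∀ l, Differentiable ℝ (J l)) {w : E}
    (hw : IsMinOn (fun w => ∑ l, J l w) Set.univ w) : ∑ l, gradient (J l) w = 0 := by
  have h := (hw.isLocalMin Filter.univ_mem).fderiv_eq_zero
  rw [fderiv_fun_sum fun l _ => hJ l w] at h
  simp only [gradient, ← map_sum, h, map_zero]

end Gradient

/-! ### Fixed points for Lipschitz, strongly monotone fields. -/

namespace Diffusion

/-- The gradient-descent step, for a family of vector fields in place of the gradients. -/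
def descend {n E : Type*} [AddCommGroup E] [Module ℝ E] (μ : n → ℝ) (g : n → E → E)
    (x : n → E) : n → E := fun k => x k - μ k • g k (x k)

section Abstract

variable {n E : Type*} [Fintype n] [NormedAddCommGroup E] [InnerProductSpace ℝ E]
  {g : n → E → E} {m L : ℝ} {μ : n → ℝ}

/-- Expanding the square gives the factor `1 - 2 μ m + μ² L²`, and `μ L² ≤ m` lets half of the
linear gain pay for the quadratic term. -/
theorem norm_step_sub_le {g : E → E} {μ : ℝ} (hLip : ∀ x y, ‖g x - g y‖ ≤ L * ‖x - y‖)
    (hmono : ∀ x y, m * ‖x - y‖ ^ 2 ≤ inner ℝ (g x - g y) (x - y)) (hμ : 0 ≤ μ)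
    (hμL : μ * L ^ 2 ≤ m) (x y : E) :
    ‖(x - μ • g x) - (y - μ • g y)‖ ≤ √(1 - μ * m) * ‖x - y‖ := by
  have hrw : (x - μ • g x) - (y - μ • g y) = (x - y) - μ • (g x - g y) := by
    rw [smul_sub]; abel
  rw [hrw]
  have h1 := hmono x y
  have h2 : ‖g x - g y‖ ^ 2 ≤ L ^ 2 * ‖x - y‖ ^ 2 := by
    rw [← mul_pow]; exact pow_le_pow_left₀ (norm_nonneg _) (hLip x y) 2
  have h3 : ‖(x - y) - μ • (g x - g y)‖ ^ 2 ≤ (1 - μ * m) * ‖x - y‖ ^ 2 := by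
    rw [norm_sub_sq_real, real_inner_smul_right, norm_smul, mul_pow, Real.norm_of_nonneg hμ,
      real_inner_comm]
    have h4 := mul_le_mul_of_nonneg_left h1 hμ
    have h5 := mul_le_mul_of_nonneg_left h2 (sq_nonneg μ)
    have h6 := mul_le_mul_of_nonneg_right (mul_le_mul_of_nonneg_left hμL hμ)
      (sq_nonneg ‖x - y‖)
    nlinarith
  calc ‖(x - y) - μ • (g x - g y)‖ ≤ √((1 - μ * m) * ‖x - y‖ ^ 2) := Real.le_sqrt_of_sq_le h3
    _ = √(1 - μ * m) * ‖x - y‖ := by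
      rw [Real.sqrt_mul' _ (sq_nonneg _), Real.sqrt_sq (norm_nonneg _)]

/-- The mean of a fixed point deviates from `u` by at most a multiple of the disagreement. -/
theorem norm_mean_le (hm : 0 < m)
    (hLip : ∀ k x y, ‖g k x - g k y‖ ≤ L * ‖x - y‖)
    (hmono : ∀ k x y, m * ‖x - y‖ ^ 2 ≤ inner ℝ (g k x - g k y) (x - y))
    {v : n → ℝ} (hv : ∀ k, 0 ≤ v k) (hv0 : 0 < ∑ k, v k) {u d : E} {x : n → E} {r : ℝ}
    (hL : 0 ≤ L) (hx : ∀ k, ‖x k - (u + d)‖ ≤ r) (hgu : ∑ k, v k • g k u = 0)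
    (hgx : ∑ k, v k • g k (x k) = 0) : ‖d‖ ≤ L / m * r := by
  -- Monotonicity compares `g k` at `u + d` and `u`; replacing `u + d` by `x k` costs at most `L r
  -- ‖d‖`.
  have hterm : ∀ k, v k * (m * ‖d‖ ^ 2) ≤
      v k * (L * r * ‖d‖) + v k * inner ℝ (g k (x k) - g k u) d := fun k => by
    rw [← mul_add]
    refine mul_le_mul_of_nonneg_left ?_ (hv k)
    have h1 := hmono k (u + d) u
    rw [add_sub_cancel_left] at h1
    have h2 : inner ℝ (g k (u + d) - g k (x k)) d ≤ L * r * ‖d‖ := by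
      refine (real_inner_le_norm _ _).trans (mul_le_mul_of_nonneg_right ?_ (norm_nonneg _))
      refine (hLip k _ _).trans (mul_le_mul_of_nonneg_left ?_ hL)
      rw [norm_sub_rev]
      exact hx k
    simp only [inner_sub_left] at h1 h2 ⊢
    linarith
  have hzero : ∑ k, v k * inner ℝ (g k (x k) - g k u) d = 0 := by
    simp only [← real_inner_smul_left, ← sum_inner, smul_sub, Finset.sum_sub_distrib, hgu, hgx,
      sub_zero, inner_zero_left]
  have hsum := Finset.sum_le_sum fun k (_ : k ∈ Finset.univ) => hterm k
  rw [Finset.sum_add_distrib, hzero, add_zero, ← Finset.sum_mul, ← Finset.sum_mul] at hsum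
  -- The total weight cancels, so the bound does not depend on the sizes of the weights.
  have h := le_of_mul_le_mul_left hsum hv0
  rcases (norm_nonneg d).eq_or_lt with h0 | h0
  · rw [div_mul_eq_mul_div, le_div_iff₀ hm, ← h0, zero_mul]
    rcases isEmpty_or_nonempty n with hn | ⟨⟨k⟩⟩
    · simp at hv0
    · exact mul_nonneg hL ((norm_nonneg _).trans (hx k))
  · rw [div_mul_eq_mul_div, le_div_iff₀ hm]
    refine le_of_mul_le_mul_right ?_ h0
    nlinarith

variable [DecidableEq n]

/-- A contraction in the sup norm. Its rate is set by the smallest step-size, so it yields no bias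
bound in terms of the largest one alone. -/
theorem existsUnique_fixedPoint [CompleteSpace E] (hm : 0 < m)
    (hLip : ∀ k x y, ‖g k x - g k y‖ ≤ L * ‖x - y‖)
    (hmono : ∀ k x y, m * ‖x - y‖ ^ 2 ≤ inner ℝ (g k x - g k y) (x - y))
    (hμ : ∀ k, 0 < μ k) (hμL : ∀ k, μ k * L ^ 2 ≤ m)
    {B₁ B₂ : Matrix n n ℝ} (hB₁ : B₁ ∈ rowStochastic ℝ n) (hB₂ : B₂ ∈ rowStochastic ℝ n) :
    ∃! w : n → E, B₂.mix (descend μ g (B₁.mix w)) = w := by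
  obtain ⟨δ, hδ, hle⟩ := Finite.exists_pos_forall_le μ hμ
  have hq : √(1 - δ * m) < 1 := by
    rw [Real.sqrt_lt' one_pos]
    nlinarith [mul_pos hδ hm]
  have hdesc : ∀ x y, ‖descend μ g x - descend μ g y‖ ≤ √(1 - δ * m) * ‖x - y‖ := fun x y => by
    refine (pi_norm_le_iff_of_nonneg (by positivity)).2 fun k => ?_
    refine (norm_step_sub_le (hLip k) (hmono k) (hμ k).le (hμL k) (x k) (y k)).trans ?_
    refine mul_le_mul (Real.sqrt_le_sqrt ?_) (norm_le_pi_norm (x - y) k) (norm_nonneg _)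
      (Real.sqrt_nonneg _)
    linarith [mul_le_mul_of_nonneg_right (hle k) hm.le]
  have hcontr : ContractingWith ⟨√(1 - δ * m), Real.sqrt_nonneg _⟩
      (fun w : n → E => B₂.mix (descend μ g (B₁.mix w))) := by
    refine ⟨by exact_mod_cast hq, LipschitzWith.of_dist_le_mul fun x y => ?_⟩
    rw [dist_eq_norm, dist_eq_norm, ← map_sub]
    calc _ ≤ _ := Matrix.norm_mix_le hB₂ _
      _ ≤ √(1 - δ * m) * ‖B₁.mix x - B₁.mix y‖ := hdesc _ _
      _ ≤ √(1 - δ * m) * ‖x - y‖ := by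
        rw [← map_sub]
        exact mul_le_mul_of_nonneg_left (Matrix.norm_mix_le hB₁ _) (Real.sqrt_nonneg _)
  exact ⟨_, hcontr.fixedPoint_isFixedPt, fun w hw => hcontr.fixedPoint_unique hw⟩

/-- The core estimate: the disagreement `z` is controlled through `I - P`, the mean `d` through `z`,
and the circular dependence on `‖e‖` is broken by `hsmall`. -/
theorem norm_fixedPoint_sub_le (hm : 0 < m) (hL : 0 ≤ L)
    (hLip : ∀ k x y, ‖g k x - g k y‖ ≤ L * ‖x - y‖)
    (hmono : ∀ k x y, m * ‖x - y‖ ^ 2 ≤ inner ℝ (g k x - g k y) (x - y))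
    {B₁ B₂ : Matrix n n ℝ} (hB₁ : B₁ ∈ rowStochastic ℝ n) (hB₂ : B₂ ∈ rowStochastic ℝ n)
    {φ : n → ℝ} (hφ : ∀ i, 0 ≤ φ i) (hφ1 : ∑ i, φ i = 1) (hφP : φ ᵥ* (B₂ * B₁) = φ)
    {κ : ℝ} (hκ : 0 ≤ κ)
    (hpoisson : ∀ z : n → E, ∑ k, φ k • z k = 0 → ‖z‖ ≤ κ * ‖z - (B₂ * B₁).mix z‖)
    (hμ : ∀ k, 0 < μ k) {s : ℝ} (hs : 0 ≤ s) (hμs : ∀ k, μ k ≤ s)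
    (hsmall : (1 + L / m) * κ * L * s ≤ 1 / 2) {u : E}
    (hu : ∑ k, ((φ ᵥ* B₂) k * μ k) • g k u = 0) {w : n → E}
    (hw : B₂.mix (descend μ g (B₁.mix w)) = w) :
    ‖w - fun _ => u‖ ≤ 2 * ((1 + L / m) * κ * ‖fun k => g k u‖) * s := by
  set x := B₁.mix w with hx
  set q : n → E := fun k => μ k • g k (x k) with hq
  have hwq : w = (B₂ * B₁).mix w - B₂.mix q := by
    rw [Matrix.mix_mul, ← map_sub]; exact hw.symm
  have hP : B₂ * B₁ ∈ rowStochastic ℝ n := mul_mem hB₂ hB₁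
  set e : n → E := w - fun _ => u with he
  set d : E := ∑ k, φ k • e k with hd
  set z : n → E := e - fun _ => d with hz
  have hz0 : ∑ k, φ k • z k = 0 := by
    simp [hz, smul_sub, Finset.sum_sub_distrib, ← Finset.sum_smul, hφ1, hd]
  -- Constant block vectors are fixed by `P`, so only `w` contributes.
  have hzP : z - (B₂ * B₁).mix z = - B₂.mix q := by
    rw [hz, he, map_sub, map_sub, Matrix.mix_const hP, Matrix.mix_const hP]
    nth_rewrite 1 [hwq]
    abel
  have hxe : ∀ k, x k - u = B₁.mix e k := fun k => by
    rw [he, map_sub, Matrix.mix_const hB₁]; rfl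
  have hqle : ‖q‖ ≤ s * (L * ‖e‖ + ‖fun k => g k u‖) := by
    refine (pi_norm_le_iff_of_nonneg (by positivity)).2 fun k => ?_
    rw [hq, norm_smul, Real.norm_of_nonneg (hμ k).le]
    refine mul_le_mul (hμs k) ?_ (norm_nonneg _) hs
    have h1 := norm_le_norm_sub_add (g k (x k)) (g k u)
    have h2 := hLip k (x k) u
    have h3 : ‖x k - u‖ ≤ ‖e‖ := by
      rw [hxe]; exact (norm_le_pi_norm _ k).trans (Matrix.norm_mix_le hB₁ e)
    have h4 := norm_le_pi_norm (fun k => g k u) k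
    have h5 := mul_le_mul_of_nonneg_left h3 hL
    linarith
  have hzle : ‖z‖ ≤ κ * (s * (L * ‖e‖ + ‖fun k => g k u‖)) := by
    refine (hpoisson z hz0).trans (mul_le_mul_of_nonneg_left ?_ hκ)
    rw [hzP, norm_neg]
    exact (Matrix.norm_mix_le hB₂ q).trans hqle
  -- Taking `φ`-means of `w = P w - B₂ q` cancels `w`, as `φ P = φ`.
  have hgx : ∑ k, ((φ ᵥ* B₂) k * μ k) • g k (x k) = 0 := by
    have h1 : ∑ k, φ k • w k = ∑ k, φ k • w k - ∑ k, (φ ᵥ* B₂) k • q k := by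
      conv_lhs => rw [hwq]
      simp only [Pi.sub_apply, smul_sub, Finset.sum_sub_distrib, Matrix.sum_smul_mix, hφP]
    simp only [mul_smul]
    exact sub_eq_self.1 h1.symm
  have hπ : ∀ k, 0 ≤ (φ ᵥ* B₂) k := nonneg_vecMul_of_mem_rowStochastic hB₂ hφ
  have hπ1 : ∑ k, (φ ᵥ* B₂) k = 1 := by
    simpa [dotProduct] using vecMul_dotProduct_one_eq_one_rowStochastic hB₂
      (x := φ) (by simpa [dotProduct] using hφ1)
  have hv0 : 0 < ∑ k, (φ ᵥ* B₂) k * μ k := by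
    obtain ⟨k, -, hk⟩ := Finset.exists_ne_zero_of_sum_ne_zero (hπ1 ▸ one_ne_zero)
    exact Finset.sum_pos' (fun k _ => mul_nonneg (hπ k) (hμ k).le)
      ⟨k, Finset.mem_univ k, mul_pos ((hπ k).lt_of_ne' hk) (hμ k)⟩
  have hdle : ‖d‖ ≤ L / m * ‖z‖ := by
    refine norm_mean_le hm hLip hmono (fun k => mul_nonneg (hπ k) (hμ k).le) hv0 hL
      (fun k => ?_) hu hgx
    have : x k - (u + d) = B₁.mix z k := by
      rw [hz, map_sub, Matrix.mix_const hB₁, Pi.sub_apply, ← hxe]; abel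
    rw [this]
    exact (norm_le_pi_norm _ k).trans (Matrix.norm_mix_le hB₁ z)
  have hele : ‖e‖ ≤ ‖z‖ + ‖d‖ := by
    refine (pi_norm_le_iff_of_nonneg (by positivity)).2 fun k => ?_
    have : e k = z k + d := by simp [hz]
    rw [this]
    exact (norm_add_le _ _).trans (by gcongr; exact norm_le_pi_norm z k)
  -- Now `‖e‖ ≤ (1 + L / m) ‖z‖`. By `hsmall` the `‖e‖` term in the bound for `z` is at most `‖e‖ /
  -- 2`; moving it to the left produces the factor 2.
  have hfac : 0 ≤ 1 + L / m := by positivity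
  have h1 := mul_le_mul_of_nonneg_left hzle hfac
  have h2 := mul_le_mul_of_nonneg_right hsmall (norm_nonneg e)
  nlinarith

end Abstract

/-! ### Transfer to the diffusion operator and the Euclidean norm. -/

section Concrete

variable {N M : ℕ}

theorem diffusionOp_eq (A₁ A₂ C : Matrix (Fin N) (Fin N) ℝ)
    (J : Fin N → EuclideanSpace ℝ (Fin M) → ℝ) (μ : Fin N → ℝ) (x : BlockVec N M) :
    diffusionOp A₁ A₂ C J μ x = WithLp.toLp 2 (A₂ᵀ.mix
      (descend μ (fun k y => ∑ l, C l k • gradient (J l) y) (A₁ᵀ.mix (WithLp.ofLp x)))) := rfl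

theorem isFixedPt_diffusionOp_iff {A₁ A₂ C : Matrix (Fin N) (Fin N) ℝ}
    {J : Fin N → EuclideanSpace ℝ (Fin M) → ℝ} {μ : Fin N → ℝ} {w : BlockVec N M} :
    Function.IsFixedPt (diffusionOp A₁ A₂ C J μ) w ↔ A₂ᵀ.mix
      (descend μ (fun k y => ∑ l, C l k • gradient (J l) y) (A₁ᵀ.mix (WithLp.ofLp w)))
        = WithLp.ofLp w := by
  rw [Function.IsFixedPt, diffusionOp_eq]
  exact ⟨fun h => congrArg WithLp.ofLp h, fun h => congrArg (WithLp.toLp 2) h⟩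

theorem norm_stack_sub_sq_le (u : EuclideanSpace ℝ (Fin M)) (w : BlockVec N M) :
    ‖stack N u - w‖ ^ 2 ≤ N * ‖WithLp.ofLp w - fun _ => u‖ ^ 2 := by
  rw [PiLp.norm_sq_eq_of_L2]
  calc ∑ k, ‖(stack N u - w) k‖ ^ 2 ≤ ∑ _k : Fin N, ‖WithLp.ofLp w - fun _ => u‖ ^ 2 := by
        refine Finset.sum_le_sum fun k _ => pow_le_pow_left₀ (norm_nonneg _) ?_ 2
        have h := norm_le_pi_norm (WithLp.ofLp w - fun _ => u) k
        rwa [Pi.sub_apply, norm_sub_rev] at h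
    _ = N * ‖WithLp.ofLp w - fun _ => u‖ ^ 2 := by simp

/-- The aggregated gradients are uniformly Lipschitz and uniformly strongly monotone. -/
theorem BoundedHessian.exists_bounds {C : Matrix (Fin N) (Fin N) ℝ} (hC : ∀ l k, 0 ≤ C l k)
    {J : Fin N → EuclideanSpace ℝ (Fin M) → ℝ} (hJ : BoundedHessian C J) :
    ∃ m L : ℝ, 0 < m ∧ 0 < L ∧
      (∀ k x y, ‖(∑ l, C l k • gradient (J l) x) - ∑ l, C l k • gradient (J l) y‖
        ≤ L * ‖x - y‖) ∧
      ∀ k x y, m * ‖x - y‖ ^ 2 ≤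
        inner ℝ ((∑ l, C l k • gradient (J l) x) - ∑ l, C l k • gradient (J l) y) (x - y) := by
  obtain ⟨hdiff, lmin, lmax, hnn, hbd, hpos⟩ := hJ
  obtain ⟨m, hm, hmle⟩ := Finite.exists_pos_forall_le _ hpos
  have hterm : ∀ l k, 0 ≤ C l k * lmax l := fun l k => mul_nonneg (hC l k) (hnn l).2
  have hS : ∀ k, 0 ≤ ∑ l, C l k * lmax l := fun k => Finset.sum_nonneg fun l _ => hterm l k
  -- Summing over `k` makes the Lipschitz constant uniform; the `+ 1` keeps it positive, as the
  -- later divisions by `L` require.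
  refine ⟨m, ∑ k, ∑ l, C l k * lmax l + 1, hm,
    add_pos_of_nonneg_of_pos (Finset.sum_nonneg fun k _ => hS k) one_pos, fun k x y => ?_,
    fun k x y => ?_⟩ <;> rw [← Finset.sum_sub_distrib] <;> simp only [← smul_sub]
  · calc ‖∑ l, C l k • (gradient (J l) x - gradient (J l) y)‖
        ≤ ∑ l, C l k * lmax l * ‖x - y‖ := norm_sum_le_of_le _ fun l _ => by
          rw [norm_smul, Real.norm_of_nonneg (hC l k), mul_assoc]
          exact mul_le_mul_of_nonneg_left (norm_image_sub_le_of_fderiv_le (hdiff l).2 (hnn l).1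
            (hnn l).2 (fun w => (hbd l w).1) (fun w => (hbd l w).2) x y) (hC l k)
      _ = (∑ l, C l k * lmax l) * ‖x - y‖ := by rw [Finset.sum_mul]
      _ ≤ _ := by
        refine mul_le_mul_of_nonneg_right ?_ (norm_nonneg _)
        linarith [Finset.single_le_sum (fun k _ => hS k) (Finset.mem_univ k)]
  · calc m * ‖x - y‖ ^ 2 ≤ (∑ l, C l k * lmin l) * ‖x - y‖ ^ 2 :=
        mul_le_mul_of_nonneg_right (hmle k) (sq_nonneg _)
      _ = ∑ l, C l k * (lmin l * ‖x - y‖ ^ 2) := by simp only [Finset.sum_mul, mul_assoc]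
      _ ≤ ∑ l, C l k * inner ℝ (gradient (J l) x - gradient (J l) y) (x - y) :=
        Finset.sum_le_sum fun l _ => mul_le_mul_of_nonneg_left
          (mul_norm_sq_le_inner_of_le_fderiv (hdiff l).2 (fun w => (hbd l w).1) x y) (hC l k)
      _ = _ := by simp only [sum_inner, real_inner_smul_left]

/-- Under the step-size condition the weighted aggregated gradients balance at a Pareto point. -/
theorem sum_smul_aggregate_eq_zero {E : Type*} [AddCommGroup E] [Module ℝ E]
    {B C : Matrix (Fin N) (Fin N) ℝ} {θ μ : Fin N → ℝ} {c : ℝ}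
    (h : θ ᵥ* (B * Matrix.diagonal μ * Cᵀ) = fun _ => c) {p : Fin N → E} (hp : ∑ l, p l = 0) :
    ∑ k, ((θ ᵥ* B) k * μ k) • ∑ l, C l k • p l = 0 := by
  have hl : ∀ l, ∑ k, (θ ᵥ* B) k * μ k * C l k = c := fun l => by
    rw [← congrFun h l, ← vecMul_vecMul, ← vecMul_vecMul]
    change _ = ∑ k, (θ ᵥ* B ᵥ* diagonal μ) k * Cᵀ k l
    simp only [vecMul_diagonal, transpose_apply]
  simp only [Finset.smul_sum, smul_smul]
  rw [Finset.sum_comm]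
  simp only [← Finset.sum_smul, hl, ← Finset.smul_sum, hp, smul_zero]

end Concrete

end Diffusion

theorem theorem3 {N M : ℕ}
    (A₁ A₂ C : Matrix (Fin N) (Fin N) ℝ)
    (hA₁ : A₁ᵀ ∈ Matrix.rowStochastic ℝ (Fin N))
    (hA₂ : A₂ᵀ ∈ Matrix.rowStochastic ℝ (Fin N))
    (hC : C ∈ Matrix.rowStochastic ℝ (Fin N))
    (J : Fin N → EuclideanSpace ℝ (Fin M) → ℝ)
    (hJ : Diffusion.BoundedHessian C J)
    (wo : EuclideanSpace ℝ (Fin M))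
    (hwo : IsMinOn (fun w => ∑ l, J l w) Set.univ wo)
    (hreg : (A₂ᵀ * A₁ᵀ).IsPrimitive)
    (θ : Fin N → ℝ) (hθ : θ ≠ 0) (hθeig : θ ᵥ* (A₂ᵀ * A₁ᵀ) = θ) :
    ∃ K μ₀ : ℝ, 0 < K ∧ 0 < μ₀ ∧
      ∀ μ : Fin N → ℝ, (∀ k, 0 < μ k ∧ μ k ≤ μ₀) →
        (∃ c₀ : ℝ, θ ᵥ* (A₂ᵀ * Matrix.diagonal μ * Cᵀ) = fun _ => c₀) →
        (∃! w : Diffusion.BlockVec N M,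
          Function.IsFixedPt (Diffusion.diffusionOp A₁ A₂ C J μ) w) ∧
        ∀ w : Diffusion.BlockVec N M,
          Function.IsFixedPt (Diffusion.diffusionOp A₁ A₂ C J μ) w →
          ‖Diffusion.stack N wo - w‖ ^ 2 ≤ K * (⨆ k, μ k) ^ 2 := by
  have : Nonempty (Fin N) := by
    obtain ⟨i, -⟩ := Function.ne_iff.1 hθ
    exact ⟨i⟩
  have hP := mul_mem hA₂ hA₁
  obtain ⟨s, hφ, hφ1⟩ := hreg.exists_smul_probability hP hθ hθeig
  have hφP : (s • θ) ᵥ* (A₂ᵀ * A₁ᵀ) = s • θ := by rw [smul_vecMul, hθeig]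
  obtain ⟨κ, hκ, hpoisson⟩ :=
    hreg.exists_norm_le_mul_norm_sub_mix hP hφ hφ1 (EuclideanSpace ℝ (Fin M))
  obtain ⟨m, L, hm, hL, hLip, hmono⟩ := hJ.exists_bounds hC.1
  have hgrad := sum_gradient_eq_zero_of_isMinOn (fun l => (hJ.1 l).1) hwo
  set b : ℝ := ‖fun k => ∑ l, C l k • gradient (J l) wo‖ with hb
  -- The factor `N` is the price of passing from the sup norm to the Euclidean one, and `+ 1` covers
  -- `b = 0`. In `μ₀`, the first bound serves the contraction, the second the absorption of the
  -- error term.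
  refine ⟨N * (2 * ((1 + L / m) * κ * b)) ^ 2 + 1,
    min (m / L ^ 2) (1 / (2 * ((1 + L / m) * κ * L))), by positivity, by positivity,
    fun μ hμ hcond => ?_⟩
  obtain ⟨c₀, hc₀⟩ := hcond
  have hsup : ∀ k, μ k ≤ ⨆ k, μ k := le_ciSup (Set.finite_range μ).bddAbove
  have hsup_le : ⨆ k, μ k ≤ 1 / (2 * ((1 + L / m) * κ * L)) :=
    ciSup_le fun k => (hμ k).2.trans (min_le_right _ _)
  have hsup0 : 0 ≤ ⨆ k, μ k := Real.iSup_nonneg fun k => (hμ k).1.le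
  have hbalance : ∑ k, (((s • θ) ᵥ* A₂ᵀ) k * μ k) • ∑ l, C l k • gradient (J l) wo = 0 := by
    refine Diffusion.sum_smul_aggregate_eq_zero (c := s * c₀) ?_ hgrad
    rw [smul_vecMul, hc₀]
    rfl
  refine ⟨?_, fun w hw => ?_⟩
  · obtain ⟨w, hw, huniq⟩ := Diffusion.existsUnique_fixedPoint hm hLip hmono (fun k => (hμ k).1)
      (fun k => (le_div_iff₀ (by positivity)).1 ((hμ k).2.trans (min_le_left _ _))) hA₁ hA₂
    exact ⟨WithLp.toLp 2 w, Diffusion.isFixedPt_diffusionOp_iff.2 hw, fun v hv =>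
      congrArg (WithLp.toLp 2) (huniq _ (Diffusion.isFixedPt_diffusionOp_iff.1 hv))⟩
  · have hsmall : (1 + L / m) * κ * L * (⨆ k, μ k) ≤ 1 / 2 := by
      rw [le_div_iff₀ (by positivity)] at hsup_le
      linarith
    have h := Diffusion.norm_fixedPoint_sub_le hm hL.le hLip hmono hA₁ hA₂ hφ hφ1 hφP hκ.le
      hpoisson (fun k => (hμ k).1) hsup0 hsup hsmall hbalance
      (Diffusion.isFixedPt_diffusionOp_iff.1 hw)
    calc ‖Diffusion.stack N wo - w‖ ^ 2 ≤ N * ‖WithLp.ofLp w - fun _ => wo‖ ^ 2 :=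
          Diffusion.norm_stack_sub_sq_le wo w
      _ ≤ N * (2 * ((1 + L / m) * κ * b) * ⨆ k, μ k) ^ 2 := by gcongr
      _ ≤ (N * (2 * ((1 + L / m) * κ * b)) ^ 2 + 1) * (⨆ k, μ k) ^ 2 := by
        nlinarith [sq_nonneg (⨆ k, μ k)]
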